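/- **Setting.** Let $\mathcal{G}_{n,m}$ be the set of pairs $(G,H)$, where $G$ is an undirected, unweighted (simple) graph on the vertices $v_1,\dots,v_n$ and $H=(h_1,\dots,h_n)$ with $h_i\in\mathbb{R}^m$. It carries the product of the discrete topology (on graphs) and the Euclidean topology (on features). For $\sigma\in S_n$, $\sigma\ast(G,H)$ is the graph relabelled by $\sigma$. A function $\Phi:\mathcal{G}_{n,m}\to\mathbb{R}$ is *permutation-invariant* if $\Phi(\sigma\ast(G,H))=\Phi(G,H)$ for all $\sigma$. A function $\Phi_v:\mathcal{G}_{n,m}\to\mathbb{R}^n$ is *permutation-equivariant* if $\Phi_v(\sigma\ast(G,H))=\sigma(\Phi_v(G,H))$ for all $\sigma$. Let $d$ be the shortest-path distance in $G$. For labels $h=(h_1,\dots,h_n)$ of the vertices, let $(G,h)_{v_i,k}$ be the subgraph of $G$ induced on $\{u: d(u,v_i)\le k\}$, rooted at $v_i$, with the labels $h$. Isomorphisms of rooted labelled graphs preserve the root and the labels. **$k$-hop subgraph GNNs.** Such a network has finitely many layers: $h_i^{(0)}=f^{(0)}(h_i)$ and $$h_i^{(l)}=f^{(l)}\Big(h_i^{(l-1)},\,g^{(l)}\big((G,h^{(l-1)})_{v_i,k}\big)\Big),\qquad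 l=1,\dots,L.$$ All features lie in Euclidean spaces (of any dimensions), all functions are continuous, and $g^{(l)}$ takes equal values on isomorphic rooted labelled graphs. With a continuous real-valued $r$, the graph-level output is $y=r(\mathrm{AGGR}\{\{h_i^{(L)}: 1\le i\le n\}\})$, where $\mathrm{AGGR}$ is a permutation-invariant operation: sum, average, or entrywise maximum. The vertex-level output is $y_i=r(h_i^{(L)})$, $i=1,\dots,n$. Let $\mathcal{F}_k$ (for a given $\mathrm{AGGR}$) and $\mathcal{F}_{k,v}$ be the sets of functions $\mathcal{G}_{n,m}\to\mathbb{R}$ and $\mathcal{G}_{n,m}\to\mathbb{R}^n$ computed by these networks. **$k$-separability.** The $k$-hop subgraph Weisfeiler-Lehman test computes colors $C_i^{(0)}=\mathrm{HASH}(h_i)$ and $C_i^{(l)}=\mathrm{HASH}\big(C_i^{(l-1)},(G,C^{(l-1)})_{v_i,k}\big)$, where rooted colored graphs are taken up to isomorphism. The pair $(G,H)$ is *$k$-separable* if, when there are no hash collisions and the partition of the vertices into color classes has stabilized, any two distinct vertices $v,v'$ for which some vertex $u$ satisfies $d(u,v)=d(u,v')=k$ have different colors. **Theorem.** Let $k\ge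 2$ and let $\mathbb{P}$ be a Borel probability measure on $\mathcal{G}_{n,m}$. Suppose that, $\mathbb{P}$-almost surely, $(G,H)$ is $k$-separable and $G$ is connected with no cycles of length greater than $2k+1$. Then the following hold. 1. For any of the above choices of $\mathrm{AGGR}$, any $\epsilon,\delta>0$ and any permutation-invariant continuous $\Phi:\mathcal{G}_{n,m}\to\mathbb{R}$, there exists $F\in\mathcal{F}_k$ such that $\mathbb{P}\big[|F(G,H)-\Phi(G,H)|>\delta\big]<\epsilon$. 2. For any $\epsilon,\delta>0$ and any permutation-equivariant continuous $\Phi_v:\mathcal{G}_{n,m}\to\mathbb{R}^n$, there exists $F_v\in\mathcal{F}_{k,v}$ such that $\mathbb{P}\big[\|F_v(G,H)-\Phi_v(G,H)\|>\delta\big]<\epsilon$, where $\|\cdot\|$ is the $\ell_2$-norm. -/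

import Mathlib

open MeasureTheory

/-- The Euclidean space `ℝ^d`. -/
abbrev Euc (d : ℕ) : Type := EuclideanSpace ℝ (Fin d)

/-! ### Graphs with vertex features -/

/-- The space `𝒢_{n,m}` of undirected unweighted graphs on `n` labelled vertices, each vertex
carrying a feature in `ℝ^m`. -/
def GraphSpace (n m : ℕ) : Type := SimpleGraph (Fin n) × (Fin n → Euc m)

namespace GraphSpace

variable {n m : ℕ}

/-- The underlying graph `G` of `(G, H)`. -/
def graph (x : GraphSpace n m) : SimpleGraph (Fin n) := x.1

/-- The vertex features `H = (h_1, …, h_n)` of `(G, H)`. -/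
def feature (x : GraphSpace n m) : Fin n → Euc m := x.2

/-- Product of the discrete topology on graphs and the Euclidean topology on features. -/
instance : TopologicalSpace (GraphSpace n m) :=
  letI : TopologicalSpace (SimpleGraph (Fin n)) := ⊥
  inferInstanceAs (TopologicalSpace (SimpleGraph (Fin n) × (Fin n → Euc m)))

/-- The Borel `σ`-algebra, so that a `Measure (GraphSpace n m)` is a Borel measure. -/
instance : MeasurableSpace (GraphSpace n m) := borel _

instance : BorelSpace (GraphSpace n m) := ⟨rfl⟩

/-- The relabelled graph `σ ∗ (G, H)`: vertex `i` of `(G, H)` becomes vertex `σ i`. -/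
def relabel (σ : Equiv.Perm (Fin n)) (x : GraphSpace n m) : GraphSpace n m :=
  (x.graph.comap σ.symm, x.feature ∘ σ.symm)

end GraphSpace

/-- `Φ (σ ∗ (G, H)) = Φ (G, H)` for every permutation `σ`. -/
def PermInvariant {n m : ℕ} (Φ : GraphSpace n m → ℝ) : Prop :=
  ∀ (σ : Equiv.Perm (Fin n)) (x : GraphSpace n m), Φ (x.relabel σ) = Φ x

/-- `Φ (σ ∗ (G, H)) = σ (Φ (G, H))` for every permutation `σ`, where `σ y` is the vector whose
entry at `σ i` is `y i`. -/
def PermEquivariant {n m : ℕ} (Φ : GraphSpace n m → Euc n) : Prop :=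
  ∀ (σ : Equiv.Perm (Fin n)) (x : GraphSpace n m),
    Φ (x.relabel σ) = WithLp.toLp 2 (fun i => Φ x (σ.symm i))

/-! ### Rooted graphs and `k`-hop subgraphs -/

/-- A finite rooted graph with vertex labels (features or colors) in `X`. -/
structure RootedGraph (X : Type*) where
  V : Type
  [finite : Finite V]
  graph : SimpleGraph V
  root : V
  label : V → X

namespace RootedGraph

variable {X : Type*}

/-- Isomorphism of rooted labelled graphs: a graph isomorphism preserving the root and all
labels. -/
def Iso (R S : RootedGraph X) : Prop :=
  ∃ φ : R.graph ≃g S.graph, φ R.root = S.root ∧ ∀ v, S.label (φ v) = R.label v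

/-- Being isomorphic, as an equivalence relation. -/
instance setoid (X : Type*) : Setoid (RootedGraph X) where
  r := Iso
  iseqv :=
    { refl := fun _ => ⟨SimpleGraph.Iso.refl, rfl, fun _ => rfl⟩
      symm := by
        rintro R S ⟨φ, h1, h2⟩
        refine ⟨φ.symm, ?_, fun v => ?_⟩
        · rw [← h1]; exact φ.symm_apply_apply _
        · rw [← h2 (φ.symm v)]; exact congrArg S.label (φ.apply_symm_apply v)
      trans := by
        rintro R S T ⟨φ, h1, h2⟩ ⟨ψ, h3, h4⟩
        refine ⟨φ.trans ψ, ?_, fun v => ?_⟩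
        · change ψ (φ R.root) = T.root
          rw [h1, h3]
        · change T.label (ψ (φ v)) = R.label v
          rw [h4, h2] }

end RootedGraph

/-- The `k`-hop subgraph `(G, h)_{v, k}`: the subgraph of `G` induced on
`𝒩_k(v) = {u : d(u, v) ≤ k}`, rooted at `v`, with labels from `h`. The distance is the
`ℕ∞`-valued one, so that vertices of other components are never included. -/
def khopSubgraph {n : ℕ} {X : Type*} (k : ℕ) (G : SimpleGraph (Fin n)) (h : Fin n → X)
    (v : Fin n) : RootedGraph X where
  V := {u : Fin n // u ∈ {w : Fin n | G.edist w v ≤ k}}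
  graph := G.induce {w : Fin n | G.edist w v ≤ k}
  root := ⟨v, by simp⟩
  label := fun u => h u

/-! ### `k`-hop subgraph GNNs -/

/-- The embedding layer and the `L` information aggregation layers of a subgraph GNN. The
feature after layer `l` lies in `ℝ^(dim l)`. The functions `f l` and `g l` are those of layer
`l + 1`; only the layers `l < L` are used. Each `g l` takes the same value on isomorphic rooted
graphs, and all functions are continuous (`g l` being continuous in the features, for each
underlying rooted graph). -/
structure SubgraphGNN (m : ℕ) where
  L : ℕ
  dim : ℕ → ℕ
  msgDim : ℕ → ℕ
  embed : Euc m → Euc (dim 0)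
  continuous_embed : Continuous embed
  f : ∀ l, Euc (dim l) → Euc (msgDim l) → Euc (dim (l + 1))
  continuous_f : ∀ l, Continuous (Function.uncurry (f l))
  g : ∀ l, RootedGraph (Euc (dim l)) → Euc (msgDim l)
  g_iso : ∀ l (R S : RootedGraph (Euc (dim l))), R.Iso S → g l R = g l S
  continuous_g : ∀ l (V : Type) [Finite V] (A : SimpleGraph V) (v : V),
    Continuous (fun h : V → Euc (dim l) => g l ⟨V, A, v, h⟩)

/-- The vertex features `h_i^{(l)}`:
`h_i^{(0)} = embed h_i` and `h_i^{(l+1)} = f (h_i^{(l)}, g ((G, h^{(l)})_{v_i, k}))`. -/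
def SubgraphGNN.hidden {n m : ℕ} (N : SubgraphGNN m) (k : ℕ) (x : GraphSpace n m) :
    (l : ℕ) → Fin n → Euc (N.dim l)
  | 0 => fun i => N.embed (x.feature i)
  | l + 1 => fun i =>
      N.f l (N.hidden k x l i) (N.g l (khopSubgraph k x.graph (N.hidden k x l) i))

/-- The usual permutation-invariant aggregation operations. -/
inductive Aggregation
  | sum
  | mean
  | max

/-- The operation `AGGR` on finite multisets of vectors (`max` is taken entrywise). -/
noncomputable def Aggregation.aggr {d : ℕ} : Aggregation → Multiset (Euc d) → Euc d
  | .sum, s => s.sum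
  | .mean, s => (s.card : ℝ)⁻¹ • s.sum
  | .max, s => WithLp.toLp 2 (fun j => sSup {t : ℝ | ∃ y ∈ s, t = y j})

/-- The space `ℱ_k` of `k`-hop subgraph GNNs with graph-level output
`y = r (AGGR {{h_i^{(L)}}})`, `r` continuous, for a given aggregation operation. -/
def graphLevelGNN (n m k : ℕ) (a : Aggregation) : Set (GraphSpace n m → ℝ) :=
  {F | ∃ (N : SubgraphGNN m) (r : Euc (N.dim N.L) → ℝ), Continuous r ∧
    ∀ x, F x = r (a.aggr (Finset.univ.val.map (N.hidden k x N.L)))}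

/-- The space `ℱ_{k,v}` of `k`-hop subgraph GNNs with vertex-level output
`y_i = r (h_i^{(L)})`, `r` continuous. -/
def vertexLevelGNN (n m k : ℕ) : Set (GraphSpace n m → Euc n) :=
  {F | ∃ (N : SubgraphGNN m) (r : Euc (N.dim N.L) → ℝ), Continuous r ∧
    ∀ x, F x = WithLp.toLp 2 (fun i => r (N.hidden k x N.L i))}

/-! ### The `k`-hop subgraph Weisfeiler-Lehman test -/

/-- Colors after `l` rounds of the test without hash collisions: the hash of an argument is the
argument itself, where rooted colored graphs are taken up to isomorphism. -/
def WLColor (m : ℕ) : ℕ → Type 1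
  | 0 => ULift.{1} (Euc m)
  | l + 1 => WLColor m l × Quotient (RootedGraph.setoid (WLColor m l))

/-- The color `C_i^{(l)}`: `C_i^{(0)} = HASH (h_i)` and
`C_i^{(l+1)} = HASH (C_i^{(l)}, (G, C^{(l)})_{v_i, k})`. -/
def wlColor {n m : ℕ} (k : ℕ) (x : GraphSpace n m) : (l : ℕ) → Fin n → WLColor m l
  | 0 => fun i => ULift.up (x.feature i)
  | l + 1 => fun i =>
      (wlColor k x l i, Quotient.mk _ (khopSubgraph k x.graph (wlColor k x l) i))

/-- The colors have stabilized after `l` rounds: one more round does not refine the partition of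
the vertices into color classes. -/
def WLStable {n m : ℕ} (k : ℕ) (x : GraphSpace n m) (l : ℕ) : Prop :=
  ∀ i j, wlColor k x l i = wlColor k x l j → wlColor k x (l + 1) i = wlColor k x (l + 1) j

/-- `(G, H)` is `k`-separable: once the colors have stabilized, any two distinct vertices `v₁`,
`v₂` at distance exactly `k` from a common vertex `u` have different colors. -/
def KSeparable {n m : ℕ} (k : ℕ) (x : GraphSpace n m) : Prop :=
  ∀ l, WLStable k x l → ∀ u v₁ v₂ : Fin n,
    x.graph.edist u v₁ = k → x.graph.edist u v₂ = k → v₁ ≠ v₂ →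
      wlColor k x l v₁ ≠ wlColor k x l v₂

/-- `G` has no cycles of length greater than `b`. -/
def NoCycleLongerThan {n : ℕ} (b : ℕ) (G : SimpleGraph (Fin n)) : Prop :=
  ∀ (v : Fin n) (c : G.Walk v v), c.IsCycle → c.length ≤ b

/-! The heart of the proof is that on connected graphs without cycles longer than `2k+1` the color
of one vertex determines the whole rooted labelled graph. By Whitney's ear argument, two vertices
that no third vertex separates are joined by two internally disjoint paths, hence adjacent or on a
common cycle, hence at distance at most `k` (`Linked.edist_le`). So the `k`-hop ball at `u` contains
every block through `u`, and an isomorphism of balls restricts to these blocks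
(`locIso_neighborhood`).

Once the colors are stable jointly on two graphs, equally colored vertices therefore have the same
blocks up to colored isomorphism, with multiplicity. An isomorphism is then grown along the block
tree, one block at a time: a counting argument (`LocIso.exists_block`) finds an unused isomorphic
block in the target, and `LocIso.glue` attaches it, since blocks meet what is already built in a
single vertex.

On the network side, each layer appends finitely many continuous symmetric functions that form a
complete isomorphism invariant of the `k`-hop subgraph. After `n * n` layers the features determine
the colors. The target function then factors through the features on a compact set of graphs of
probability greater than `1 - ε`, and Tietze extension makes the factor a continuous readout. On
that set the network equals the target exactly. -/

/-! ### Vertices that are not separated by a cut vertex -/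

namespace SimpleGraph

variable {V : Type*} {G : SimpleGraph V} {A B : Set V} {u v w a b : V}

/-- Some walk from `u` to `v` stays inside `A`. -/
def ReachIn (G : SimpleGraph V) (A : Set V) (u v : V) : Prop :=
  ∃ p : G.Walk u v, ∀ x ∈ p.support, x ∈ A

theorem ReachIn.refl (h : u ∈ A) : G.ReachIn A u u := ⟨.nil, by simpa using h⟩

theorem ReachIn.symm (h : G.ReachIn A u v) : G.ReachIn A v u := by
  obtain ⟨p, hp⟩ := h
  exact ⟨p.reverse, by simpa using hp⟩

theorem ReachIn.trans (h : G.ReachIn A u v) (h' : G.ReachIn A v w) : G.ReachIn A u w := by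
  obtain ⟨p, hp⟩ := h
  obtain ⟨q, hq⟩ := h'
  refine ⟨p.append q, fun x hx => ?_⟩
  rcases (Walk.mem_support_append_iff p q).1 hx with h | h
  exacts [hp x h, hq x h]

theorem ReachIn.mono (hAB : A ⊆ B) (h : G.ReachIn A u v) : G.ReachIn B u v := by
  obtain ⟨p, hp⟩ := h
  exact ⟨p, fun x hx => hAB (hp x hx)⟩

theorem ReachIn.left_mem (h : G.ReachIn A u v) : u ∈ A := by
  obtain ⟨p, hp⟩ := h
  exact hp _ p.start_mem_support

theorem ReachIn.right_mem (h : G.ReachIn A u v) : v ∈ A := h.symm.left_mem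

theorem ReachIn.exists_isPath (h : G.ReachIn A u v) :
    ∃ p : G.Walk u v, p.IsPath ∧ ∀ x ∈ p.support, x ∈ A := by
  classical
  obtain ⟨p, hp⟩ := h
  exact ⟨p.bypass, p.bypass_isPath, fun x hx => hp x (p.support_bypass_subset_support hx)⟩

theorem Adj.reachIn (h : G.Adj u v) (hu : u ∈ A) (hv : v ∈ A) : G.ReachIn A u v :=
  ⟨h.toWalk, by simp [hu, hv]⟩

theorem ReachIn.map {W : Type*} {G' : SimpleGraph W} {f : V → W} {A' : Set W}
    (hA : ∀ x ∈ A, f x ∈ A') (hf : ∀ x ∈ A, ∀ y ∈ A, G.Adj x y → G'.Adj (f x) (f y))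
    (h : G.ReachIn A u v) : G'.ReachIn A' (f u) (f v) := by
  obtain ⟨p, hp⟩ := h
  induction p with
  | nil => exact .refl (hA _ (hp _ (by simp)))
  | @cons x y z hxy p ih =>
    have hx : x ∈ A := hp _ (by simp)
    have hy : y ∈ A := hp _ (by simp)
    exact ((hf x hx y hy hxy).reachIn (hA _ hx) (hA _ hy)).trans
      (ih fun t ht => hp t (by simp [ht]))

/-- The vertices `u` and `v` are connected in `G[A]`, and no third vertex separates them. -/
def Linked (G : SimpleGraph V) (A : Set V) (u v : V) : Prop :=
  G.ReachIn A u v ∧ ∀ c, c ≠ u → c ≠ v → G.ReachIn (A \ {c}) u v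

theorem Linked.refl (h : u ∈ A) : G.Linked A u u :=
  ⟨.refl h, fun _ hc _ => .refl ⟨h, hc.symm⟩⟩

theorem Linked.symm (h : G.Linked A u v) : G.Linked A v u :=
  ⟨h.1.symm, fun c h1 h2 => (h.2 c h2 h1).symm⟩

theorem linked_comm : G.Linked A u v ↔ G.Linked A v u := ⟨.symm, .symm⟩

theorem Linked.mono (hAB : A ⊆ B) (h : G.Linked A u v) : G.Linked B u v :=
  ⟨h.1.mono hAB, fun c h1 h2 => (h.2 c h1 h2).mono (Set.sdiff_subset_sdiff_left hAB)⟩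

theorem Adj.linked (h : G.Adj u v) (hu : u ∈ A) (hv : v ∈ A) : G.Linked A u v :=
  ⟨h.reachIn hu hv, fun _ h1 h2 => h.reachIn ⟨hu, h1.symm⟩ ⟨hv, h2.symm⟩⟩

theorem Linked.map {W : Type*} {G' : SimpleGraph W} {f : V → W} {A' : Set W}
    (hA : Set.BijOn f A A') (hf : ∀ x ∈ A, ∀ y ∈ A, G.Adj x y → G'.Adj (f x) (f y))
    (h : G.Linked A u v) : G'.Linked A' (f u) (f v) := by
  refine ⟨h.1.map hA.mapsTo hf, fun c h1 h2 => ?_⟩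
  by_cases hc : c ∈ A'
  · obtain ⟨d, hd, rfl⟩ := hA.surjOn hc
    refine (h.2 d (fun e => h1 (e ▸ rfl)) (fun e => h2 (e ▸ rfl))).map (fun x hx => ?_)
      (fun x hx y hy => hf x hx.1 y hy.1)
    exact ⟨hA.mapsTo hx.1, fun e => hx.2 (hA.injOn hx.1 hd e)⟩
  · refine (h.1.map hA.mapsTo hf).mono fun x hx => ⟨hx, fun e => hc (e ▸ hx)⟩

/-- Two vertices that are both linked to two distinct vertices are linked. -/
theorem Linked.glue (hne : u ≠ v) (hau : G.Linked A a u) (hav : G.Linked A a v)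
    (hbu : G.Linked A b u) (hbv : G.Linked A b v) : G.Linked A a b := by
  refine ⟨hau.1.trans hbu.1.symm, fun c h1 h2 => ?_⟩
  by_cases hc : c = u
  · have hcv : c ≠ v := fun e => hne (hc.symm.trans e)
    exact (hav.2 c h1 hcv).trans (hbv.2 c h2 hcv).symm
  · exact (hau.2 c h1 hc).trans (hbu.2 c h2 hc).symm

/-- Paths between linked vertices consist of vertices linked to the end points. -/
theorem Linked.of_mem_support (h : G.Linked A u v) {p : G.Walk u v} (hp : p.IsPath)
    (hpA : ∀ x ∈ p.support, x ∈ A) (hw : w ∈ p.support) : G.Linked A w u := by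
  obtain ⟨q, r, hq, hr, rfl⟩ := hp.mem_support_iff_exists_append.1 hw
  have hqA : ∀ x ∈ q.support, x ∈ A := fun x hx =>
    hpA x ((Walk.mem_support_append_iff q r).2 (.inl hx))
  have hrA : ∀ x ∈ r.support, x ∈ A := fun x hx =>
    hpA x ((Walk.mem_support_append_iff q r).2 (.inr hx))
  refine ⟨ReachIn.symm ⟨q, hqA⟩, fun c h1 h2 => ?_⟩
  -- A path visits `c` only once, so one of its two halves avoids `c`. If that half leads to `v`,
  -- the hypothesis on `u` and `v` supplies the way from `v` back to `u`.
  by_cases hcq : c ∈ q.support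
  · have hcr : c ∉ r.support := fun hcr => hp.ne_of_mem_support_of_append h1 hcq hcr rfl
    have hcv : c ≠ v := fun e => hcr (e ▸ r.end_mem_support)
    refine ReachIn.trans ⟨r, fun x hx => ⟨hrA x hx, ?_⟩⟩ (h.2 c h2 hcv).symm
    rintro rfl
    exact hcr hx
  · refine ReachIn.symm ⟨q, fun x hx => ⟨hqA x hx, ?_⟩⟩
    rintro rfl
    exact hcq hx

theorem Linked.of_mem_support' (h : G.Linked A u v) {p : G.Walk u v} (hp : p.IsPath)
    (hpA : ∀ x ∈ p.support, x ∈ A) (hw : w ∈ p.support) : G.Linked A w v :=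
  h.symm.of_mem_support (p := p.reverse) hp.reverse (by simpa using hpA) (by simpa using hw)

/-! ### Internally disjoint paths -/

/-- The walk is cut at its first visit to `S` and then freed of repetitions. -/
theorem Walk.exists_walk_to_set (S : Set V) (p : G.Walk u v) (hv : v ∈ S) :
    ∃ q ∈ S, ∃ r : G.Walk u q, r.IsPath ∧ (∀ x ∈ r.support, x ∈ p.support) ∧
      ∀ x ∈ r.support, x ∈ S → x = q := by
  classical
  suffices H : ∃ q ∈ S, ∃ r : G.Walk u q, (∀ x ∈ r.support, x ∈ p.support) ∧
      ∀ x ∈ r.support, x ∈ S → x = q by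
    obtain ⟨q, hq, r, h1, h2⟩ := H
    exact ⟨q, hq, r.bypass, r.bypass_isPath,
      fun x hx => h1 x (r.support_bypass_subset_support hx),
      fun x hx => h2 x (r.support_bypass_subset_support hx)⟩
  induction p with
  | nil => exact ⟨_, hv, .nil, by simp, by simp⟩
  | @cons x y z hxy p ih =>
    by_cases hx : x ∈ S
    · exact ⟨x, hx, .nil, by simp, by simp⟩
    · obtain ⟨q, hq, r, h1, h2⟩ := ih hv
      refine ⟨q, hq, .cons hxy r, ?_, ?_⟩
      · simp only [Walk.support_cons, List.mem_cons]
        rintro t (rfl | ht)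
        exacts [.inl rfl, .inr (h1 t ht)]
      · simp only [Walk.support_cons, List.mem_cons]
        rintro t (rfl | ht) htS
        exacts [absurd htS hx, h2 t ht htS]

theorem Walk.IsPath.append' {p : G.Walk u v} {q : G.Walk v w} (hp : p.IsPath) (hq : q.IsPath)
    (h : ∀ x ∈ p.support, x ∈ q.support → x = v) : (p.append q).IsPath := by
  rw [Walk.isPath_def, Walk.support_append, List.nodup_append']
  have hq' := hq.support_nodup
  rw [← Walk.cons_tail_support, List.nodup_cons] at hq'
  refine ⟨hp.support_nodup, hq'.2, fun x hx hx' => ?_⟩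
  have := h x hx (List.mem_of_mem_tail hx')
  exact hq'.1 (this ▸ hx')

/-- There are two paths from `u` to `v` that only meet at their end points. (Both may be the
same edge.) -/
def TwoPaths (G : SimpleGraph V) (u v : V) : Prop :=
  ∃ p q : G.Walk u v, p.IsPath ∧ q.IsPath ∧ ∀ x ∈ p.support, x ∈ q.support → x = u ∨ x = v

/-- The ear step: follow the detour from `w` until it first meets one of the two paths, at `t`. One
new path runs along that path to `t` and back along the detour to `w`; the other is the second old
path followed by the edge from `v` to `w`. -/
theorem TwoPaths.step (h : G.TwoPaths u v) (hvw : G.Adj v w) (hwu : w ≠ u) (huv : u ≠ v)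
    (hr : G.ReachIn {v}ᶜ w u) : G.TwoPaths u w := by
  classical
  obtain ⟨p, q, hp, hq, hpq⟩ := h
  obtain ⟨r, hr⟩ := hr
  obtain ⟨t, ht, s, hs, hsr, hst⟩ := r.exists_walk_to_set {x | x ∈ p.support ∨ x ∈ q.support}
    (.inl p.start_mem_support)
  wlog htp : t ∈ p.support generalizing p q
  · exact this q p hq hp (fun x h1 h2 => hpq x h2 h1) (ht.symm)
      (fun x hx hx' => hst x hx hx'.symm) (ht.resolve_left htp)
  have htv : t ≠ v := fun e => hr t (hsr t s.end_mem_support) e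
  have hwv : w ≠ v := hvw.ne'
  have hwq : w ∉ q.support := fun hwq => by
    have hwt : w = t := hst w s.start_mem_support (.inr hwq)
    rcases hpq w (hwt ▸ htp) hwq with h | h
    exacts [hwu h, hwv h]
  have hsub : ∀ x ∈ (p.takeUntil t htp).support, x ∈ p.support := fun x hx =>
    p.support_takeUntil_subset_support htp hx
  refine ⟨(p.takeUntil t htp).append s.reverse, q.concat hvw,
    (hp.takeUntil htp).append' hs.reverse ?_, hq.concat hwq hvw, ?_⟩
  · intro x hx hx'
    exact hst x (by simpa using hx') (.inl (hsub x hx))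
  · intro x hx hx'
    rw [Walk.support_concat, List.mem_append, List.mem_singleton] at hx'
    rcases hx' with hx' | hx'
    · left
      rcases (Walk.mem_support_append_iff _ _).1 hx with h | h
      · rcases hpq x (hsub x h) hx' with h' | h'
        · exact h'
        · exact absurd (h' ▸ h) (Walk.endpoint_notMem_support_takeUntil hp htp htv.symm)
      · have hxt : x = t := hst x (by simpa using h) (.inr hx')
        exact (hpq x (hxt ▸ htp) hx').resolve_right fun e => htv (hxt.symm.trans e)
    · exact .inr hx'

/-- Induction along the walk, starting with one edge used twice. The detour required by
`TwoPaths.step` exists because the next vertex `y` does not separate `x` from `u`. -/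
theorem twoPaths_of_walk (p : G.Walk w u) (hp : ∀ x ∈ p.support, G.Linked Set.univ x u)
    (hwu : w ≠ u) : G.TwoPaths u w := by
  induction p with
  | nil => exact absurd rfl hwu
  | @cons x y z hxy p ih =>
    by_cases hyz : y = z
    · subst hyz
      have he : (hxy.symm.toWalk).IsPath := by simp [Walk.isPath_def, hxy.ne']
      exact ⟨hxy.symm.toWalk, hxy.symm.toWalk, he, he, by simp⟩
    · refine (ih (fun t ht => hp t (by simp [ht])) hyz).step hxy.symm hwu (Ne.symm hyz) ?_
      exact ((hp x (by simp)).2 y hxy.ne' hyz).mono (by simp [Set.compl_eq_univ_sdiff])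

/-- Linked vertices are at distance at most half the largest cycle length. -/
theorem Linked.edist_le {k : ℕ} (hk : 1 ≤ k)
    (hG : ∀ (v : V) (c : G.Walk v v), c.IsCycle → c.length ≤ 2 * k + 1)
    (h : G.Linked Set.univ u v) : G.edist u v ≤ k := by
  by_cases huv : u = v
  · simp [huv]
  obtain ⟨r, hr, -⟩ := h.1.exists_isPath
  obtain ⟨p, q, hp, hq, hpq⟩ := twoPaths_of_walk r.reverse
    (fun x hx => h.of_mem_support hr (by simp) (by simpa using hx)) (Ne.symm huv)
  -- Otherwise the two paths close up to a cycle of length at least `2k+2`; as `1 ≤ k`, they are not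
  -- the same single edge.
  have key : p.length ≤ k ∨ q.length ≤ k := by
    by_contra! hlen
    have hc : (p.append q.reverse).IsCycle := by
      refine hp.isCycle_append (q.isPath_reverse_iff.2 hq) (fun x h1 h2 => ?_) (.inl (by omega))
      have hu : x ≠ u := by
        rintro rfl
        have := hp.support_nodup
        rw [← Walk.cons_tail_support, List.nodup_cons] at this
        exact this.1 h1
      have hv : x ≠ v := by
        rintro rfl
        have := hq.reverse.support_nodup
        rw [← Walk.cons_tail_support, List.nodup_cons] at this
        exact this.1 h2
      have := hpq x (List.mem_of_mem_tail h1) (by simpa using List.mem_of_mem_tail h2)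
      exact this.elim hu hv
    have := hG _ _ hc
    rw [Walk.length_append, Walk.length_reverse] at this
    omega
  rcases key with h | h
  · exact (Walk.edist_le p).trans (by exact_mod_cast h)
  · exact (Walk.edist_le q).trans (by exact_mod_cast h)

end SimpleGraph

/-! ### Blocks -/

namespace SimpleGraph

section Block

variable {V : Type*} {G : SimpleGraph V} {S : Set V} {u v w a p q s : V}

/-- The vertices linked to both `u` and `a`: for distinct linked `u`, `a`, this is the block
containing them. -/
def block (G : SimpleGraph V) (u a : V) : Set V :=
  {w | G.Linked Set.univ w u ∧ G.Linked Set.univ w a}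

theorem linked_of_mem_block (hne : u ≠ a) (hp : p ∈ G.block u a) (hq : q ∈ G.block u a) :
    G.Linked Set.univ p q :=
  .glue hne hp.1 hp.2 hq.1 hq.2

theorem left_mem_block (h : G.Linked Set.univ u a) : u ∈ G.block u a :=
  ⟨.refl trivial, h⟩

theorem right_mem_block (h : G.Linked Set.univ u a) : a ∈ G.block u a :=
  ⟨h.symm, .refl trivial⟩

/-- By `Linked.glue`, any two distinct vertices of a block determine it; hence distinct blocks share
at most one vertex. -/
theorem block_eq_of_mem (hne : u ≠ a) (hp : p ∈ G.block u a)
    (hq : q ∈ G.block u a) (hpq : p ≠ q) : G.block p q = G.block u a := by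
  ext w
  constructor
  · rintro ⟨h1, h2⟩
    exact ⟨.glue hpq h1 h2 hp.1.symm hq.1.symm, .glue hpq h1 h2 hp.2.symm hq.2.symm⟩
  · exact fun hw => ⟨linked_of_mem_block hne hw hp, linked_of_mem_block hne hw hq⟩

theorem reachIn_block (h : G.Linked Set.univ p q) :
    G.ReachIn (G.block p q) p q := by
  obtain ⟨r, hr, -⟩ := h.1.exists_isPath
  exact ⟨r, fun x hx => ⟨h.of_mem_support hr (by simp) hx, h.of_mem_support' hr (by simp) hx⟩⟩

/-- A connected union of blocks. -/
structure IsSaturated (G : SimpleGraph V) (S : Set V) : Prop where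
  reachIn : ∀ p ∈ S, ∀ q ∈ S, G.ReachIn S p q
  block_subset : ∀ p ∈ S, ∀ q ∈ S, p ≠ q → G.Linked Set.univ p q → G.block p q ⊆ S

theorem isSaturated_singleton : G.IsSaturated {u} where
  reachIn := by
    rintro p rfl q rfl
    exact .refl rfl
  block_subset := by
    rintro p rfl q rfl h
    exact absurd rfl h

theorem IsSaturated.notMem_of_mem_block (hS : G.IsSaturated S) (hu : u ∈ S) (ha : a ∉ S)
    (h : G.Linked Set.univ u a) (hw : w ∈ G.block u a) (hwu : w ≠ u) : w ∉ S := fun hwS => by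
  have hne : u ≠ a := fun e => ha (e ▸ hu)
  have := block_eq_of_mem hne (left_mem_block h) hw hwu.symm
  exact ha (hS.block_subset u hu w hwS hwu.symm hw.1.symm (this ▸ right_mem_block h))

/-- The vertex `u` cuts the new block off from the rest of `S`. A walk avoiding `u` would first
enter `S` at some `t`, and continuing inside `S` gives a path from `w` through `t` to `u`. Then `w`
lies in the block of `t` and `u`, which is contained in `S`. -/
theorem IsSaturated.not_reachIn (hS : G.IsSaturated S) (hu : u ∈ S) (ha : a ∉ S)
    (h : G.Linked Set.univ u a) (hw : w ∈ G.block u a) (hwu : w ≠ u) (hs : s ∈ S) :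
    ¬ G.ReachIn {u}ᶜ w s := by
  rintro ⟨r, hr⟩
  have hwS := hS.notMem_of_mem_block hu ha h hw hwu
  obtain ⟨t, ht, r', hr', hsub, hfirst⟩ := r.exists_walk_to_set S hs
  have htu : t ≠ u := fun e => hr t (hsub t r'.end_mem_support) e
  obtain ⟨z, hz, hzS⟩ := (hS.reachIn t ht u hu).exists_isPath
  have hpath : (r'.append z).IsPath := hr'.append' hz fun x hx hx' => hfirst x hx (hzS x hx')
  have htmem : t ∈ (r'.append z).support :=
    (Walk.mem_support_append_iff _ _).2 (.inr z.start_mem_support)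
  have htw := hw.1.of_mem_support hpath (by simp) htmem
  have htu' := hw.1.of_mem_support' hpath (by simp) htmem
  exact hwS (hS.block_subset t ht u hu htu htu' ⟨htw.symm, hw.1⟩)

theorem IsSaturated.not_linked (hS : G.IsSaturated S) (hu : u ∈ S) (ha : a ∉ S)
    (h : G.Linked Set.univ u a) (hw : w ∈ G.block u a) (hwu : w ≠ u) (hs : s ∈ S) (hsu : s ≠ u) :
    ¬ G.Linked Set.univ w s := fun hl =>
  hS.not_reachIn hu ha h hw hwu hs
    ((hl.2 u hwu.symm hsu.symm).mono (by simp [Set.compl_eq_univ_sdiff]))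

theorem IsSaturated.not_adj (hS : G.IsSaturated S) (hu : u ∈ S) (ha : a ∉ S)
    (h : G.Linked Set.univ u a) (hw : w ∈ G.block u a) (hwu : w ≠ u) (hs : s ∈ S) (hsu : s ≠ u) :
    ¬ G.Adj w s := fun hl =>
  hS.not_linked hu ha h hw hwu hs hsu (hl.linked trivial trivial)

/-- Apart from pairs involving `u`, no vertex of `S` is linked to a new vertex, so the block of a
linked pair is either inside `S` or the new one. -/
theorem IsSaturated.union_block (hS : G.IsSaturated S) (hu : u ∈ S) (ha : a ∉ S)
    (h : G.Linked Set.univ u a) : G.IsSaturated (S ∪ G.block u a) where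
  reachIn := by
    have hne : u ≠ a := fun e => ha (e ▸ hu)
    suffices H : ∀ p ∈ S ∪ G.block u a, G.ReachIn (S ∪ G.block u a) p u from
      fun p hp q hq => (H p hp).trans (H q hq).symm
    rintro p (hp | hp)
    · exact (hS.reachIn p hp u hu).mono Set.subset_union_left
    · by_cases hpu : p = u
      · rw [hpu]
        exact .refl (.inl hu)
      · have := reachIn_block hp.1
        rw [block_eq_of_mem hne hp (left_mem_block h) hpu] at this
        exact this.mono Set.subset_union_right
  block_subset := by
    have hne : u ≠ a := fun e => ha (e ▸ hu)
    intro p hp q hq hpq hl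
    by_cases hpS : p ∈ S <;> by_cases hqS : q ∈ S
    · exact (hS.block_subset p hpS q hqS hpq hl).trans Set.subset_union_left
    · have hqB := hq.resolve_left hqS
      by_cases hpu : p = u
      · subst hpu
        rw [block_eq_of_mem hne (left_mem_block h) hqB hpq]
        exact Set.subset_union_right
      · exact absurd hl.symm (hS.not_linked hu ha h hqB (fun e => hqS (e ▸ hu)) hpS hpu)
    · have hpB := hp.resolve_left hpS
      by_cases hqu : q = u
      · subst hqu
        rw [block_eq_of_mem hne hpB (left_mem_block h) hpq]
        exact Set.subset_union_right
      · exact absurd hl (hS.not_linked hu ha h hpB (fun e => hpS (e ▸ hu)) hqS hqu)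
    · rw [block_eq_of_mem hne (hp.resolve_left hpS) (hq.resolve_left hqS) hpq]
      exact Set.subset_union_right

end Block

/-! ### Gluing isomorphisms of blocks -/

section LocIso

variable {V V' V'' C : Type*} {G : SimpleGraph V} {G' : SimpleGraph V'} {G'' : SimpleGraph V''}
  {c : V → C} {c' : V' → C} {c'' : V'' → C} {S B : Set V} {S' : Set V'} {S'' : Set V''}
  {f : V → V'} {u a p q : V}

/-- `f` is an isomorphism from `G[S]` to `G'[S']` that preserves colors and being linked. -/
structure LocIso (G : SimpleGraph V) (G' : SimpleGraph V') (c : V → C) (c' : V' → C)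
    (S : Set V) (S' : Set V') (f : V → V') : Prop where
  bijOn : Set.BijOn f S S'
  color : ∀ p ∈ S, c' (f p) = c p
  adj : ∀ p ∈ S, ∀ q ∈ S, G'.Adj (f p) (f q) ↔ G.Adj p q
  linked : ∀ p ∈ S, ∀ q ∈ S, G'.Linked Set.univ (f p) (f q) ↔ G.Linked Set.univ p q

theorem LocIso.symm [Nonempty V] (h : LocIso G G' c c' S S' f) :
    ∃ g, LocIso G' G c' c S' S g ∧ (∀ x ∈ S, g (f x) = x) ∧ ∀ x ∈ S', f (g x) = x := by
  have hinv := h.bijOn.invOn_invFunOn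
  have hg := hinv.symm.bijOn h.bijOn.surjOn.mapsTo_invFunOn h.bijOn.mapsTo
  refine ⟨_, ⟨hg, fun p hp => ?_, fun p hp q hq => ?_, fun p hp q hq => ?_⟩,
    fun x hx => hinv.1 hx, fun x hx => hinv.2 hx⟩
  · rw [← h.color _ (hg.mapsTo hp), hinv.2 hp]
  · rw [← h.adj _ (hg.mapsTo hp) _ (hg.mapsTo hq), hinv.2 hp, hinv.2 hq]
  · rw [← h.linked _ (hg.mapsTo hp) _ (hg.mapsTo hq), hinv.2 hp, hinv.2 hq]

theorem LocIso.comp {g : V' → V''} (hg : LocIso G' G'' c' c'' S' S'' g)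
    (hf : LocIso G G' c c' S S' f) : LocIso G G'' c c'' S S'' (g ∘ f) where
  bijOn := hg.bijOn.comp hf.bijOn
  color p hp := (hg.color _ (hf.bijOn.mapsTo hp)).trans (hf.color p hp)
  adj p hp q hq := (hg.adj _ (hf.bijOn.mapsTo hp) _ (hf.bijOn.mapsTo hq)).trans (hf.adj p hp q hq)
  linked p hp q hq :=
    (hg.linked _ (hf.bijOn.mapsTo hp) _ (hf.bijOn.mapsTo hq)).trans (hf.linked p hp q hq)

theorem LocIso.restrict (h : LocIso G G' c c' S S' f) (hB : B ⊆ S) :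
    LocIso G G' c c' B (f '' B) f where
  bijOn := (h.bijOn.injOn.mono hB).bijOn_image
  color p hp := h.color p (hB hp)
  adj p hp q hq := h.adj p (hB hp) q (hB hq)
  linked p hp q hq := h.linked p (hB hp) q (hB hq)

theorem LocIso.image_block (h : LocIso G G' c c' S S' f) (hp : p ∈ S) (hq : q ∈ S)
    (hS : G.block p q ⊆ S) (hS' : G'.block (f p) (f q) ⊆ S') :
    f '' G.block p q = G'.block (f p) (f q) := by
  ext y
  constructor
  · rintro ⟨x, hx, rfl⟩
    exact ⟨(h.linked _ (hS hx) _ hp).2 hx.1, (h.linked _ (hS hx) _ hq).2 hx.2⟩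
  · intro hy
    obtain ⟨x, hx, rfl⟩ := h.bijOn.surjOn (hS' hy)
    exact ⟨x, ⟨(h.linked _ hx _ hp).1 hy.1, (h.linked _ hx _ hq).1 hy.2⟩, rfl⟩

/-- The blocks of `G'` at `u'` that are isomorphic to the set `B` rooted at `u`. -/
def blocksIso (G : SimpleGraph V) (G' : SimpleGraph V') (c : V → C) (c' : V' → C)
    (B : Set V) (u : V) (u' : V') : Set (Set V') :=
  {B' | (∃ p, G'.Linked Set.univ u' p ∧ u' ≠ p ∧ B' = G'.block u' p) ∧
    ∃ f, LocIso G G' c c' B B' f ∧ f u = u'}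

/-- The condition `hS'` ensures that the image is a whole block, not a part of one. This transports
blocks both by the local isomorphism and by the inverse of the partial one. -/
theorem LocIso.image_mem_blocksIso {u' : V'} (hf : LocIso G G' c c' S S' f) (hu : u ∈ S)
    (hfu : f u = u')
    (hS' : ∀ p ∈ S, G'.Linked Set.univ u' (f p) → u' ≠ f p → G'.block u' (f p) ⊆ S')
    {W : Type*} {H : SimpleGraph W} {d : W → C} {D : Set W} {w : W} {E : Set V} (hES : E ⊆ S)
    (hE : E ∈ blocksIso H G d c D w u) : f '' E ∈ blocksIso H G' d c' D w u' := by
  obtain ⟨⟨p, hup, hne, rfl⟩, g, hg, hgw⟩ := hE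
  have hp : p ∈ S := hES (right_mem_block hup)
  have hl : G'.Linked Set.univ u' (f p) := hfu ▸ (hf.linked u hu p hp).2 hup
  have hne' : u' ≠ f p := fun e => hne (hf.bijOn.injOn hu hp (hfu.trans e))
  refine ⟨⟨f p, hl, hne', ?_⟩, f ∘ g, (hf.restrict hES).comp hg, by simp [hgw, hfu]⟩
  have := hf.image_block hu hp hES (by rw [hfu]; exact hS' p hp hl hne')
  rwa [hfu] at this

/-- If a saturated set misses a block at `u`, then its isomorphic image misses an isomorphic block
at the image of `u`. -/
theorem LocIso.exists_block [Finite V] [Finite V'] (hf : LocIso G G' c c' S S' f)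
    (hS : G.IsSaturated S) (hS' : G'.IsSaturated S') (hu : u ∈ S) (ha : a ∉ S)
    (hua : G.Linked Set.univ u a) {g : V → V'}
    (hg : LocIso G G' c c' {w | G.Linked Set.univ w u} {w | G'.Linked Set.univ w (f u)} g)
    (hgu : g u = f u) :
    ∃ a' ∉ S', G'.Linked Set.univ (f u) a' ∧
      ∃ θ, LocIso G G' c c' (G.block u a) (G'.block (f u) a') θ ∧ θ u = f u := by
  have hne : u ≠ a := fun e => ha (e ▸ hu)
  have : Nonempty V := ⟨u⟩
  have : Nonempty V' := ⟨f u⟩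
  by_contra hcon
  push Not at hcon
  -- Compare the numbers of blocks isomorphic to the missing one. The neighborhood isomorphism `g`
  -- shows that `f u` has at least as many as `u`. If all those at `f u` were inside `S'`, the
  -- inverse of `f` would inject them into the ones at `u` other than the missing block, one fewer.
  have hsub : ∀ E ∈ blocksIso G G' c c' (G.block u a) u (f u), E ⊆ S' := by
    rintro E ⟨⟨p, hup, hne', rfl⟩, θ, hθ, hθu⟩
    by_contra hE
    have hp : p ∉ S' := fun hp => hE (hS'.block_subset _ (hf.bijOn.mapsTo hu) _ hp hne' hup)
    exact hcon p hp hup θ hθ hθu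
  have hfu' := hf.bijOn.mapsTo hu
  obtain ⟨e, he, hef, hfe⟩ := hf.symm
  have h1 : (blocksIso G G c c (G.block u a) u u).ncard ≤
      (blocksIso G G' c c' (G.block u a) u (f u)).ncard := by
    refine Set.ncard_le_ncard_of_injOn (fun E => g '' E) (fun E hE => ?_) ?_ (Set.toFinite _)
    · refine hg.image_mem_blocksIso (.refl trivial) hgu (fun p hp _ _ x hx => hx.1) ?_ hE
      obtain ⟨⟨p, -, -, rfl⟩, -⟩ := hE
      exact fun x hx => hx.1
    · intro E hE F hF hEF
      obtain ⟨⟨p, -, -, rfl⟩, -⟩ := hE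
      obtain ⟨⟨q, -, -, rfl⟩, -⟩ := hF
      exact (hg.bijOn.injOn.image_eq_image_iff (fun x hx => hx.1) (fun x hx => hx.1)).1 hEF
  have h2 : (blocksIso G G' c c' (G.block u a) u (f u)).ncard ≤
      (blocksIso G G c c (G.block u a) u u \ {G.block u a}).ncard := by
    refine Set.ncard_le_ncard_of_injOn (fun E => e '' E) (fun E hE => ⟨?_, ?_⟩) ?_ (Set.toFinite _)
    · exact he.image_mem_blocksIso hfu' (hef u hu) (fun p hp hl hne => hS.block_subset _ hu _
        (he.bijOn.mapsTo hp) hne hl) (hsub E hE) hE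
    · intro h
      have haE : a ∈ e '' E := by
        have h' : e '' E = G.block u a := h
        rw [h']
        exact right_mem_block hua
      obtain ⟨x, hx, rfl⟩ := haE
      exact ha (he.bijOn.mapsTo (hsub E hE hx))
    · intro E hE F hF hEF
      exact (he.bijOn.injOn.image_eq_image_iff (hsub E hE) (hsub F hF)).1 hEF
  have h3 : (blocksIso G G c c (G.block u a) u u \ {G.block u a}).ncard <
      (blocksIso G G c c (G.block u a) u u).ncard := by
    refine Set.ncard_sdiff_singleton_lt_of_mem
      ⟨⟨a, hua, hne, rfl⟩, id, ⟨Set.bijOn_id _, ?_, ?_, ?_⟩, rfl⟩ (Set.toFinite _)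
    all_goals simp
  omega

/-- Extending an isomorphism of saturated sets by an isomorphism of blocks. -/
theorem LocIso.glue (hf : LocIso G G' c c' S S' f)
    (hS : G.IsSaturated S) (hS' : G'.IsSaturated S') (hu : u ∈ S) (ha : a ∉ S)
    (hua : G.Linked Set.univ u a) {a' : V'} (ha' : a' ∉ S')
    (hua' : G'.Linked Set.univ (f u) a') {θ : V → V'}
    (hθ : LocIso G G' c c' (G.block u a) (G'.block (f u) a') θ) (hθu : θ u = f u) :
    ∃ h, LocIso G G' c c' (S ∪ G.block u a) (S' ∪ G'.block (f u) a') h ∧ ∀ x ∈ S, h x = f x := by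
  classical
  have hfu := hf.bijOn.mapsTo hu
  have hB : ∀ x ∈ G.block u a, (if x ∈ S then f x else θ x) = θ x := by
    intro x hx
    by_cases hxu : x = u
    · subst hxu
      simp [hu, hθu]
    · simp [hS.notMem_of_mem_block hu ha hua hx hxu]
  have hne : ∀ x ∈ G.block u a, x ∉ S → θ x ≠ f u := fun x hx hxS e =>
    hxS (hθ.bijOn.injOn hx (left_mem_block hua) (e.trans hθu.symm) ▸ hu)
  -- Between old and new vertices all adjacencies and links pass through `u`, where `f` and `θ`
  -- agree; elsewhere both sides are false.
  have hcross : ∀ x ∈ G.block u a, x ∉ S → ∀ y ∈ S,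
      f y ≠ θ x ∧ (G'.Adj (θ x) (f y) ↔ G.Adj x y) ∧
        (G'.Linked Set.univ (θ x) (f y) ↔ G.Linked Set.univ x y) := by
    intro x hx hxS y hy
    have hxu : x ≠ u := fun e => hxS (e ▸ hu)
    have hx' := hθ.bijOn.mapsTo hx
    have hxu' := hne x hx hxS
    refine ⟨fun e => ?_, ?_⟩
    · exact hS'.notMem_of_mem_block hfu ha' hua' hx' hxu' (e ▸ hf.bijOn.mapsTo hy)
    by_cases hyu : y = u
    · subst hyu
      rw [← hθu]
      exact ⟨hθ.adj x hx y (left_mem_block hua), hθ.linked x hx y (left_mem_block hua)⟩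
    · have hyu' : f y ≠ f u := fun e => hyu (hf.bijOn.injOn hy hu e)
      have hy' := hf.bijOn.mapsTo hy
      exact ⟨iff_of_false (hS'.not_adj hfu ha' hua' hx' hxu' hy' hyu')
          (hS.not_adj hu ha hua hx hxu hy hyu),
        iff_of_false (hS'.not_linked hfu ha' hua' hx' hxu' hy' hyu')
          (hS.not_linked hu ha hua hx hxu hy hyu)⟩
  refine ⟨fun x => if x ∈ S then f x else θ x, ⟨⟨?_, ?_, ?_⟩, ?_, ?_, ?_⟩, fun x hx => if_pos hx⟩
  · rintro x (hx | hx)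
    · simpa [hx] using .inl (hf.bijOn.mapsTo hx)
    · simp only [hB x hx]
      exact .inr (hθ.bijOn.mapsTo hx)
  · intro x hx y hy hxy
    by_cases hxS : x ∈ S <;> by_cases hyS : y ∈ S <;> simp only [hxS, hyS, if_true, if_false] at hxy
    · exact hf.bijOn.injOn hxS hyS hxy
    · exact absurd hxy (hcross y (hy.resolve_left hyS) hyS x hxS).1
    · exact absurd hxy.symm (hcross x (hx.resolve_left hxS) hxS y hyS).1
    · exact hθ.bijOn.injOn (hx.resolve_left hxS) (hy.resolve_left hyS) hxy
  · rintro y (hy | hy)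
    · obtain ⟨x, hx, rfl⟩ := hf.bijOn.surjOn hy
      exact ⟨x, .inl hx, if_pos hx⟩
    · obtain ⟨x, hx, rfl⟩ := hθ.bijOn.surjOn hy
      exact ⟨x, .inr hx, hB x hx⟩
  · rintro x hx
    by_cases hxS : x ∈ S <;> simp only [hxS, if_true, if_false]
    · exact hf.color x hxS
    · exact hθ.color x (hx.resolve_left hxS)
  · intro x hx y hy
    by_cases hxS : x ∈ S <;> by_cases hyS : y ∈ S <;> simp only [hxS, hyS, if_true, if_false]
    · exact hf.adj x hxS y hyS
    · rw [adj_comm, G.adj_comm]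
      exact (hcross y (hy.resolve_left hyS) hyS x hxS).2.1
    · exact (hcross x (hx.resolve_left hxS) hxS y hyS).2.1
    · exact hθ.adj x (hx.resolve_left hxS) y (hy.resolve_left hyS)
  · intro x hx y hy
    by_cases hxS : x ∈ S <;> by_cases hyS : y ∈ S <;> simp only [hxS, hyS, if_true, if_false]
    · exact hf.linked x hxS y hyS
    · rw [linked_comm, G.linked_comm]
      exact (hcross y (hy.resolve_left hyS) hyS x hxS).2.2
    · exact (hcross x (hx.resolve_left hxS) hxS y hyS).2.2
    · exact hθ.linked x (hx.resolve_left hxS) y (hy.resolve_left hyS)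

/-- If equally colored vertices have isomorphic neighborhoods (unions of the blocks containing
them), then equally colored vertices are exchanged by an embedding of the whole graph. -/
theorem exists_locIso_univ [Finite V] [Finite V'] (hG : G.Connected)
    (hloc : ∀ u u', c u = c' u' → ∃ g,
      LocIso G G' c c' {w | G.Linked Set.univ w u} {w | G'.Linked Set.univ w u'} g ∧ g u = u')
    {v : V} {v' : V'} (hv : c v = c' v') :
    ∃ f S', LocIso G G' c c' Set.univ S' f ∧ f v = v' := by
  suffices H : ∀ (N : ℕ) (S : Set V) (S' : Set V') (f : V → V'), Sᶜ.ncard ≤ N → v ∈ S →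
      G.IsSaturated S → G'.IsSaturated S' → LocIso G G' c c' S S' f → f v = v' →
      ∃ f S', LocIso G G' c c' Set.univ S' f ∧ f v = v' by
    refine H _ {v} {v'} (fun _ => v') le_rfl rfl isSaturated_singleton isSaturated_singleton
      ⟨⟨?_, ?_, ?_⟩, ?_, ?_, ?_⟩ rfl
    · simp [Set.MapsTo]
    · simp
    · simp [Set.SurjOn]
    · simp [hv]
    · simp
    · rintro p rfl q rfl
      simp [Linked.refl]
  intro N
  induction N with
  | zero =>
    intro S S' f hN hvS hS hS' hf hfv
    rw [Nat.le_zero, Set.ncard_eq_zero (Set.toFinite _), Set.compl_empty_iff] at hN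
    exact ⟨f, S', hN ▸ hf, hfv⟩
  | succ N ih =>
    intro S S' f hN hvS hS hS' hf hfv
    by_cases hSu : S = Set.univ
    · exact ⟨f, S', hSu ▸ hf, hfv⟩
    obtain ⟨b, hb⟩ := (Set.ne_univ_iff_exists_notMem S).1 hSu
    -- By connectedness some edge leaves `S`; its block is the next one to attach.
    obtain ⟨r⟩ := hG.preconnected v b
    obtain ⟨d, hd, hdS, hdS'⟩ := r.exists_boundary_dart S hvS hb
    have hl : G.Linked Set.univ d.fst d.snd := d.adj.linked trivial trivial
    obtain ⟨g, hg, hgu⟩ := hloc d.fst (f d.fst) (hf.color _ hdS).symm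
    obtain ⟨a', ha', hua', θ, hθ, hθu⟩ := hf.exists_block hS hS' hdS hdS' hl hg hgu
    obtain ⟨h, hh, hhf⟩ := hf.glue hS hS' hdS hdS' hl ha' hua' hθ hθu
    refine ih _ _ h ?_ (.inl hvS) (hS.union_block hdS hdS' hl)
      (hS'.union_block (hf.bijOn.mapsTo hdS) ha' hua') hh ((hhf v hvS).trans hfv)
    refine Nat.le_of_lt_succ (lt_of_lt_of_le (Set.ncard_lt_ncard ?_ (Set.toFinite _)) hN)
    refine compl_lt_compl_iff_lt.2 ?_
    exact ⟨Set.subset_union_left, fun hsub => hdS' (hsub (.inr (right_mem_block hl)))⟩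

end LocIso

end SimpleGraph

/-! ### Recovering blocks from balls -/

namespace SimpleGraph

variable {V V' C : Type*} {G : SimpleGraph V} {G' : SimpleGraph V'} {c : V → C} {c' : V' → C}
  {A : Set V} {A' : Set V'} {f : V → V'} {u p q : V}

/-- Every path between `p` and `q` stays among vertices linked to both, and by `Linked.glue` these
are linked to `u`. Thus the ball sees all relevant paths. -/
theorem Linked.of_neighborhood_subset (hA : {w | G.Linked Set.univ w u} ⊆ A)
    (hp : G.Linked Set.univ p u) (hq : G.Linked Set.univ q u) (h : G.Linked Set.univ p q) :
    G.Linked A p q := by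
  by_cases hpq : p = q
  · subst hpq
    exact .refl (hA hp)
  have key : ∀ r : G.Walk p q, r.IsPath → ∀ x ∈ r.support, x ∈ A := fun r hr x hx =>
    hA (.glue hpq (h.of_mem_support hr (by simp) hx) (h.of_mem_support' hr (by simp) hx)
      hp.symm hq.symm)
  obtain ⟨r, hr, -⟩ := h.1.exists_isPath
  refine ⟨⟨r, key r hr⟩, fun d h1 h2 => ?_⟩
  obtain ⟨r, hr, hr'⟩ := (h.2 d h1 h2).exists_isPath
  exact ⟨r, fun x hx => ⟨key r hr x hx, (hr' x hx).2⟩⟩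

/-- An isomorphism of induced subgraphs that contain all blocks at the respective roots restricts
to an isomorphism of the unions of these blocks. -/
theorem locIso_neighborhood (hf : Set.BijOn f A A')
    (hadj : ∀ x ∈ A, ∀ y ∈ A, G'.Adj (f x) (f y) ↔ G.Adj x y) (hc : ∀ x ∈ A, c' (f x) = c x)
    (hA : {w | G.Linked Set.univ w u} ⊆ A) (hA' : {w | G'.Linked Set.univ w (f u)} ⊆ A') :
    LocIso G G' c c' {w | G.Linked Set.univ w u} {w | G'.Linked Set.univ w (f u)} f := by
  have hu : G.Linked Set.univ u u := .refl trivial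
  have hu' : G'.Linked Set.univ (f u) (f u) := .refl trivial
  have : Nonempty V := ⟨u⟩
  have hinv := hf.invOn_invFunOn
  have hg := hinv.symm.bijOn hf.surjOn.mapsTo_invFunOn hf.mapsTo
  have hgadj : ∀ x ∈ A', ∀ y ∈ A', G'.Adj x y →
      G.Adj (Function.invFunOn f A x) (Function.invFunOn f A y) := fun x hx y hy h => by
    rwa [← hadj _ (hg.mapsTo hx) _ (hg.mapsTo hy), hinv.2 hx, hinv.2 hy]
  -- An isomorphism of balls only controls links realized inside the balls. `of_neighborhood_subset`
  -- and monotonicity convert these to and from links in the whole graphs.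
  have hlA : ∀ x ∈ A, ∀ y ∈ A, G'.Linked A' (f x) (f y) ↔ G.Linked A x y := by
    intro x hx y hy
    refine ⟨fun h => ?_, fun h => h.map hf fun a ha b hb => (hadj a ha b hb).2⟩
    have := h.map hg hgadj
    rwa [hinv.1 hx, hinv.1 hy] at this
  have hiff : ∀ x, G.Linked A x u → G'.Linked Set.univ (f x) (f u) := fun x hx =>
    ((hlA x hx.1.left_mem u hx.1.right_mem).2 hx).mono (Set.subset_univ _)
  have hto : ∀ x, G.Linked Set.univ x u → G.Linked A x u := fun x hx =>
    .of_neighborhood_subset hA hx hu hx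
  have hlink : ∀ x, G.Linked Set.univ x u → ∀ y, G.Linked Set.univ y u →
      (G'.Linked Set.univ (f x) (f y) ↔ G.Linked Set.univ x y) := by
    refine fun x hx y hy => ⟨fun h => ?_, fun h => ?_⟩
    · exact ((hlA x (hA hx) y (hA hy)).1 (.of_neighborhood_subset hA' (hiff x (hto x hx))
        (hiff y (hto y hy)) h)).mono (Set.subset_univ _)
    · exact ((hlA x (hA hx) y (hA hy)).2 (.of_neighborhood_subset hA hx hy h)).mono
        (Set.subset_univ _)
  refine ⟨⟨fun x hx => hiff x (hto x hx), hf.injOn.mono hA, fun y hy => ?_⟩,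
    fun x hx => hc x (hA hx), fun x hx y hy => hadj x (hA hx) y (hA hy),
    fun x hx y hy => hlink x hx y hy⟩
  obtain ⟨x, hx, rfl⟩ := hf.surjOn (hA' hy)
  exact ⟨x, ((hlA x hx u (hA hu)).1 (.of_neighborhood_subset hA' hy hu' hy)).mono
    (Set.subset_univ _), rfl⟩

end SimpleGraph

/-! ### The power of the Weisfeiler-Lehman test -/

section WL

variable {n m k : ℕ} {x y : GraphSpace n m} {i j : Fin n}

theorem wlColor_eq_of_le {l l' : ℕ} (hl : l ≤ l') (h : wlColor k x l' i = wlColor k y l' j) :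
    wlColor k x l i = wlColor k y l j := by
  induction hl with
  | refl => exact h
  | step _ ih => exact ih (congrArg Prod.fst h)

theorem feature_eq_of_wlColor_eq {l : ℕ} (h : wlColor k x l i = wlColor k y l j) :
    x.feature i = y.feature j :=
  congrArg ULift.down (wlColor_eq_of_le (Nat.zero_le l) h)

/-- Comparing two graphs, the test stabilizes after at most `n ^ 2` rounds. -/
theorem exists_wlColor_stable (k : ℕ) (x y : GraphSpace n m) :
    ∃ l ≤ n * n, ∀ i j, wlColor k x l i = wlColor k y l j →
      wlColor k x (l + 1) i = wlColor k y (l + 1) j := by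
  -- The set of equally colored pairs shrinks with each refining round, and it starts with at most
  -- `n * n` elements.
  let E : ℕ → Set (Fin n × Fin n) := fun l => {p | wlColor k x l p.1 = wlColor k y l p.2}
  by_contra! hcon
  have hlt : ∀ l ≤ n * n, (E (l + 1)).ncard < (E l).ncard := by
    intro l hl
    obtain ⟨i, j, h1, h2⟩ := hcon l hl
    refine Set.ncard_lt_ncard ⟨fun p hp => wlColor_eq_of_le (Nat.le_succ l) hp, fun hsub => ?_⟩
      (Set.toFinite _)
    exact h2 (hsub (a := (i, j)) h1)
  have hle : ∀ l ≤ n * n + 1, (E l).ncard + l ≤ n * n := by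
    intro l
    induction l with
    | zero =>
      intro _
      refine (Set.ncard_le_card _).trans ?_
      simp
    | succ l ih =>
      intro hl
      have := hlt l (by omega)
      have := ih (by omega)
      omega
  have := hle (n * n + 1) le_rfl
  omega

theorem RootedGraph.Iso.exists_bijOn {X : Type*} {G G' : SimpleGraph (Fin n)} {c c' : Fin n → X}
    (h : (khopSubgraph k G c i).Iso (khopSubgraph k G' c' j)) :
    ∃ f : Fin n → Fin n, Set.BijOn f {w | G.edist w i ≤ k} {w | G'.edist w j ≤ k} ∧ f i = j ∧
      (∀ a, G.edist a i ≤ k → ∀ b, G.edist b i ≤ k → (G'.Adj (f a) (f b) ↔ G.Adj a b)) ∧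
      ∀ a, G.edist a i ≤ k → c' (f a) = c a := by
  classical
  obtain ⟨φ, hroot, hlab⟩ := h
  change (G.induce {w | G.edist w i ≤ k}) ≃g (G'.induce {w | G'.edist w j ≤ k}) at φ
  have hf : ∀ a (ha : G.edist a i ≤ k),
      (if h : G.edist a i ≤ k then (φ ⟨a, h⟩ : Fin n) else j) = φ ⟨a, ha⟩ :=
    fun a ha => dif_pos ha
  refine ⟨fun a => if h : G.edist a i ≤ k then φ ⟨a, h⟩ else j, ⟨?_, ?_, ?_⟩, ?_, ?_, ?_⟩
  · intro a ha
    simp only [hf a ha]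
    exact (φ ⟨a, ha⟩).2
  · intro a ha b hb hab
    simp only [hf a ha, hf b hb] at hab
    exact congrArg Subtype.val (φ.injective (Subtype.ext hab))
  · intro b hb
    obtain ⟨⟨a, ha⟩, hab⟩ := φ.surjective ⟨b, hb⟩
    exact ⟨a, ha, (hf a ha).trans (congrArg Subtype.val hab)⟩
  · have hi : G.edist i i ≤ k := by simp
    simp only [hf i hi]
    exact congrArg Subtype.val hroot
  · intro a ha b hb
    simp only [hf a ha, hf b hb]
    exact φ.map_adj_iff (v := ⟨a, ha⟩) (w := ⟨b, hb⟩)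
  · intro a ha
    simp only [hf a ha]
    exact hlab ⟨a, ha⟩

/-- On connected graphs without cycles longer than `2k+1`, the color of a single vertex determines
the labelled graph rooted at this vertex up to isomorphism. -/
theorem exists_relabel_of_wlColor_eq (hk : 1 ≤ k) (hx : x.graph.Connected)
    (hxc : NoCycleLongerThan (2 * k + 1) x.graph) (hyc : NoCycleLongerThan (2 * k + 1) y.graph)
    (h : wlColor k x (n * n) i = wlColor k y (n * n) j) :
    ∃ σ : Equiv.Perm (Fin n), y = x.relabel σ ∧ σ i = j := by
  obtain ⟨l, hl, hst⟩ := exists_wlColor_stable k x y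
  obtain ⟨f, S', hf, hfi⟩ := SimpleGraph.exists_locIso_univ (G := x.graph) (G' := y.graph)
    (c := wlColor k x l) (c' := wlColor k y l) hx (fun u u' hu => by
      obtain ⟨f, hf, rfl, hadj, hc⟩ := (Quotient.exact
        (congrArg Prod.snd (hst u u' hu)) : RootedGraph.Iso _ _).exists_bijOn
      exact ⟨f, SimpleGraph.locIso_neighborhood hf hadj hc
        (fun w hw => SimpleGraph.Linked.edist_le hk hxc hw)
        (fun w hw => SimpleGraph.Linked.edist_le hk hyc hw), rfl⟩)
    (wlColor_eq_of_le hl h)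
  -- Both graphs have `n` vertices, so the embedding is onto.
  let σ : Equiv.Perm (Fin n) := Equiv.ofBijective f
    (Finite.injective_iff_bijective.1 (Set.injOn_univ.1 hf.bijOn.injOn))
  have hσ : ∀ a, f (σ.symm a) = a := fun a => σ.apply_symm_apply a
  refine ⟨σ, Prod.ext ?_ ?_, hfi⟩
  · ext a b
    have := hf.adj (σ.symm a) trivial (σ.symm b) trivial
    rw [hσ, hσ] at this
    exact this
  · funext a
    have := feature_eq_of_wlColor_eq (hf.color (σ.symm a) trivial)
    rw [hσ] at this
    exact this

end WL

/-! ### Complete continuous invariants of rooted graphs -/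

section Separation

open Polynomial

variable {κ : Type*} [Fintype κ]

/-- The polynomial whose coefficients are the entries of a vector. -/
noncomputable def vectorPolynomial (v : κ → ℝ) : ℝ[X] :=
  ∑ a, C (v a) * X ^ (Fintype.equivFin κ a : ℕ)

theorem natDegree_vectorPolynomial_le (v : κ → ℝ) :
    (vectorPolynomial v).natDegree ≤ Fintype.card κ := by
  refine natDegree_sum_le_of_forall_le _ _ fun a _ => ?_
  exact (natDegree_C_mul_X_pow_le _ _).trans (Fin.is_lt _).le

theorem vectorPolynomial_injective : Function.Injective (vectorPolynomial (κ := κ)) := by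
  intro v w h
  funext a
  have key : ∀ v : κ → ℝ, (vectorPolynomial v).coeff (Fintype.equivFin κ a) = v a := by
    intro v
    simp only [vectorPolynomial, finsetSum_coeff, coeff_C_mul, coeff_X_pow]
    rw [Finset.sum_eq_single a]
    · simp
    · intro b _ hb
      have : (Fintype.equivFin κ a : ℕ) ≠ Fintype.equivFin κ b := fun h =>
        hb ((Fintype.equivFin κ).injective (Fin.ext h.symm))
      simp [this]
    · simp
  rw [← key v, ← key w, h]

theorem eval_vectorPolynomial (v : κ → ℝ) (s : ℝ) :
    (vectorPolynomial v).eval s = ∑ a, v a * s ^ (Fintype.equivFin κ a : ℕ) := by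
  simp [vectorPolynomial, eval_finsetSum]

/-- Polynomials of degree at most `D` that agree at `0, …, D` are equal. -/
theorem eq_of_eval_natCast_eq {p q : ℝ[X]} {D : ℕ} (hp : p.natDegree ≤ D) (hq : q.natDegree ≤ D)
    (h : ∀ s : Fin (D + 1), p.eval (s : ℝ) = q.eval (s : ℝ)) : p = q := by
  refine eq_of_natDegree_lt_card_of_eval_eq p q (f := fun s : Fin (D + 1) => (s : ℝ))
    (fun a b hab => Fin.ext (Nat.cast_injective hab)) h ?_
  rw [Fintype.card_fin]
  omega

theorem natDegree_prod_le_mul {J : Type*} [Fintype J] {N D : ℕ} {y : J → ℝ[X]}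
    (hJ : Fintype.card J ≤ N) (hy : ∀ j, (y j).natDegree ≤ D) : (∏ j, y j).natDegree ≤ N * D := by
  refine (natDegree_prod_le _ _).trans ((Finset.sum_le_sum fun j _ => hy j).trans ?_)
  simpa using Nat.mul_le_mul_right D hJ

/-- Finitely many symmetric functions separate disjoint finite families of vectors. -/
theorem exists_eq_of_prod_eq {ι ι' : Type*} [Fintype ι] [Fintype ι'] {N : ℕ}
    (hι : Fintype.card ι ≤ N) (hι' : Fintype.card ι' ≤ N) (z : ι → κ → ℝ) (z' : ι' → κ → ℝ)
    (h : ∀ (t : Fin (N + 1)) (s : Fin (N * Fintype.card κ + 1)),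
      ∏ i, ((t : ℝ) - (vectorPolynomial (z i)).eval (s : ℝ)) =
        ∏ i, ((t : ℝ) - (vectorPolynomial (z' i)).eval (s : ℝ))) (i : ι) :
    ∃ i', z i = z' i' := by
  -- For fixed `s`, both products have degree at most `N` in the variable sampled by `t`, so `N + 1`
  -- values identify them.
  have h1 : ∀ s : Fin (N * Fintype.card κ + 1),
      (∏ i, (X - C ((vectorPolynomial (z i)).eval (s : ℝ))) : ℝ[X]) =
        ∏ i, (X - C ((vectorPolynomial (z' i)).eval (s : ℝ))) := by
    intro s
    refine eq_of_eval_natCast_eq (D := N) ?_ ?_ fun t => ?_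
    · exact (natDegree_prod_le_mul hι fun j => (natDegree_X_sub_C _).le).trans (mul_one N).le
    · exact (natDegree_prod_le_mul hι' fun j => (natDegree_X_sub_C _).le).trans (mul_one N).le
    · simpa [eval_prod] using h t s
  -- Substituting the value of the polynomial of `z i` at `s` makes the left product vanish. The
  -- resulting product of differences has enough zeros to be the zero polynomial, so one factor
  -- vanishes.
  have h2 : ∏ i', (vectorPolynomial (z i) - vectorPolynomial (z' i')) = 0 := by
    refine eq_of_eval_natCast_eq (D := N * Fintype.card κ) (natDegree_prod_le_mul hι' fun j => ?_) (by simp)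
      fun s => ?_
    · exact (natDegree_sub_le _ _).trans
        (max_le (natDegree_vectorPolynomial_le _) (natDegree_vectorPolynomial_le _))
    · have := congrArg (eval ((vectorPolynomial (z i)).eval (s : ℝ))) (h1 s)
      simp only [eval_prod, eval_sub, eval_X, eval_C] at this
      simp only [eval_prod, eval_sub, eval_zero]
      rw [← this]
      exact Finset.prod_eq_zero (Finset.mem_univ i) (sub_self _)
  obtain ⟨i', -, hi'⟩ := Finset.prod_eq_zero_iff.1 h2
  exact ⟨i', vectorPolynomial_injective (sub_eq_zero.1 hi')⟩

end Separation

namespace RootedGraph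

variable {n d : ℕ} {R S : RootedGraph (Euc d)}

/-- Index set of the entries describing a rooted graph with vertices enumerated by `Fin n`. -/
abbrev CodeIndex (n d : ℕ) : Type :=
  (Fin n × Fin d) ⊕ (Fin n × Fin n) ⊕ (Fin n × Fin n) ⊕ Fin n

open Classical in
/-- The labels, the adjacency matrix and the root of `R`, in terms of an enumeration `φ` of the
vertices, possibly with repetitions. -/
noncomputable def code (R : RootedGraph (Euc d)) (φ : Fin n → R.V) : CodeIndex n d → ℝ :=
  Sum.elim (fun p => R.label (φ p.1) p.2) <|
    Sum.elim (fun p => if R.graph.Adj (φ p.1) (φ p.2) then 1 else 0) <|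
      Sum.elim (fun p => if φ p.1 = φ p.2 then 1 else 0) fun a => if φ a = R.root then 1 else 0

/-- The codes record which indices name the same vertex, so matching vertices by index is a
well-defined bijection despite repetitions. -/
theorem iso_of_code_eq {φ : Fin n → R.V} {ψ : Fin n → S.V} (hφ : φ.Surjective)
    (hψ : ψ.Surjective) (h : R.code φ = S.code ψ) : R.Iso S := by
  classical
  have ite_iff : ∀ {p q : Prop} [Decidable p] [Decidable q],
      (if p then (1 : ℝ) else 0) = (if q then 1 else 0) → (p ↔ q) := by
    intro p q _ _ hpq
    by_cases hp : p <;> by_cases hq : q <;> simp_all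
  have hlab : ∀ a, R.label (φ a) = S.label (ψ a) := fun a => by
    ext b
    exact congrFun h (.inl (a, b))
  have hadj : ∀ a b, R.graph.Adj (φ a) (φ b) ↔ S.graph.Adj (ψ a) (ψ b) := fun a b =>
    ite_iff (congrFun h (.inr (.inl (a, b))))
  have heq : ∀ a b, φ a = φ b ↔ ψ a = ψ b := fun a b =>
    ite_iff (congrFun h (.inr (.inr (.inl (a, b)))))
  have hroot : ∀ a, φ a = R.root ↔ ψ a = S.root := fun a =>
    ite_iff (congrFun h (.inr (.inr (.inr a))))
  let g := Function.surjInv hφ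
  have hg : ∀ v, φ (g v) = v := Function.surjInv_eq hφ
  have hbij : Function.Bijective (ψ ∘ g) := by
    constructor
    · intro v w hvw
      have := (heq (g v) (g w)).2 hvw
      rwa [hg, hg] at this
    · intro w
      obtain ⟨a, rfl⟩ := hψ w
      exact ⟨φ a, (heq _ _).1 (hg _)⟩
  refine ⟨⟨Equiv.ofBijective _ hbij, ?_⟩, ?_, ?_⟩
  · intro v w
    have := hadj (g v) (g w)
    rw [hg, hg] at this
    exact this.symm
  · exact (hroot (g R.root)).1 (hg _)
  · intro v
    have := hlab (g v)
    rw [hg] at this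
    exact this.symm

/-- Index set of a complete set of invariants of rooted graphs with at most `n` vertices. -/
abbrev InvariantIndex (n d : ℕ) : Type :=
  Fin (n ^ n + 1) × Fin (n ^ n * Fintype.card (CodeIndex n d) + 1)

/-- Invariants of rooted graphs that are complete for at most `n` vertices: symmetric functions of
the codes for all enumerations. -/
noncomputable def invariant (n : ℕ) (R : RootedGraph (Euc d)) :
    Euc (Fintype.card (InvariantIndex n d)) :=
  WithLp.toLp 2 fun a =>
    ∏ᶠ φ : {φ : Fin n → R.V // φ.Surjective},
      ((((Fintype.equivFin (InvariantIndex n d)).symm a).1 : ℝ) -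
        (vectorPolynomial (R.code φ.1)).eval
          (((Fintype.equivFin (InvariantIndex n d)).symm a).2 : ℝ))

theorem invariant_eq_of_iso (n : ℕ) (h : R.Iso S) : R.invariant n = S.invariant n := by
  classical
  obtain ⟨θ, hroot, hlab⟩ := h
  refine congrArg (WithLp.toLp 2) (funext fun a => ?_)
  let e : {φ : Fin n → R.V // φ.Surjective} ≃ {φ : Fin n → S.V // φ.Surjective} :=
    (Equiv.arrowCongr (Equiv.refl _) θ.toEquiv).subtypeEquiv fun φ => by
      exact (θ.toEquiv.comp_surjective φ).symm
  refine finprod_eq_of_bijective e e.bijective fun φ => ?_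
  have : S.code (e φ).1 = R.code φ.1 := by
    have he : ∀ a, (e φ).1 a = θ (φ.1 a) := fun a => rfl
    funext c
    rcases c with c | c | c | c
    · simp [code, he, hlab]
    · refine if_congr ?_ rfl rfl
      rw [he, he]
      exact θ.map_adj_iff
    · refine if_congr ?_ rfl rfl
      rw [he, he]
      exact θ.injective.eq_iff
    · refine if_congr ?_ rfl rfl
      rw [he, ← hroot]
      exact θ.injective.eq_iff
  rw [this]

theorem continuous_invariant (n : ℕ) (V : Type) [Finite V] (A : SimpleGraph V) (v : V) :
    Continuous fun h : V → Euc d => invariant n ⟨V, A, v, h⟩ := by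
  classical
  have := Fintype.ofFinite {φ : Fin n → V // φ.Surjective}
  refine (PiLp.continuous_toLp 2 _).comp (continuous_pi fun a => ?_)
  simp only [finprod_eq_prod_of_fintype, eval_vectorPolynomial]
  refine continuous_finsetProd _ fun φ _ => continuous_const.sub
    (continuous_finsetSum _ fun c _ => Continuous.mul ?_ continuous_const)
  rcases c with c | c | c | c
  · simp only [code, Sum.elim_inl]
    fun_prop
  · exact continuous_const (y := if A.Adj (φ.1 c.1) (φ.1 c.2) then (1 : ℝ) else 0)
  · exact continuous_const (y := if φ.1 c.1 = φ.1 c.2 then (1 : ℝ) else 0)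
  · exact continuous_const (y := if φ.1 c = v then (1 : ℝ) else 0)

/-- There are at most `n ^ n` enumerations, so the invariants determine the set of their codes, and
one shared code suffices. With at most `n` vertices an enumeration exists. -/
theorem iso_of_invariant_eq (hR : Nat.card R.V ≤ n) (hS : Nat.card S.V ≤ n)
    (h : R.invariant n = S.invariant n) : R.Iso S := by
  classical
  have := R.finite
  have := S.finite
  have := Fintype.ofFinite R.V
  have := Fintype.ofFinite S.V
  rw [Nat.card_eq_fintype_card] at hR hS
  have hcard : ∀ (V : Type) [Fintype V], Fintype.card V ≤ n →
      Fintype.card {φ : Fin n → V // φ.Surjective} ≤ n ^ n := by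
    intro V _ hV
    refine (Fintype.card_subtype_le _).trans ?_
    simpa using Nat.pow_le_pow_left hV n
  obtain ⟨φ, hφ⟩ : ∃ φ : Fin n → R.V, φ.Surjective := by
    obtain ⟨e⟩ : Nonempty (R.V ↪ Fin n) := by
      rw [Function.Embedding.nonempty_iff_card_le]
      simpa using hR
    have : Nonempty R.V := ⟨R.root⟩
    exact ⟨_, Function.invFun_surjective e.injective⟩
  obtain ⟨ψ, hψ⟩ := exists_eq_of_prod_eq (hcard _ hR) (hcard _ hS)
    (fun φ : {φ : Fin n → R.V // φ.Surjective} => R.code φ.1)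
    (fun φ : {φ : Fin n → S.V // φ.Surjective} => S.code φ.1) (fun t s => by
      have := congrArg (fun w : Euc _ => w (Fintype.equivFin (InvariantIndex n d) (t, s))) h
      simpa [invariant, finprod_eq_prod_of_fintype] using this) ⟨φ, hφ⟩
  exact iso_of_code_eq hφ ψ.2 hψ

end RootedGraph

/-! ### A network that is as powerful as the Weisfeiler-Lehman test -/

/-- Concatenation of vectors. -/
noncomputable def Euc.append {a b : ℕ} (u : Euc a) (v : Euc b) : Euc (a + b) :=
  WithLp.toLp 2 (Fin.append u.ofLp v.ofLp)

theorem Euc.continuous_append {a b : ℕ} :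
    Continuous (Function.uncurry (Euc.append (a := a) (b := b))) := by
  refine (PiLp.continuous_toLp 2 _).comp (continuous_pi fun i => ?_)
  refine Fin.addCases (fun i => ?_) (fun i => ?_) i
  · simp only [Fin.append_left]
    fun_prop
  · simp only [Fin.append_right]
    fun_prop

theorem Euc.append_inj {a b : ℕ} {u u' : Euc a} {v v' : Euc b}
    (h : Euc.append u v = Euc.append u' v') : u = u' ∧ v = v' := by
  have h' := congrArg WithLp.ofLp h
  constructor
  · ext i
    simpa [Euc.append] using congrFun h' (Fin.castAdd b i)
  · ext i
    simpa [Euc.append] using congrFun h' (Fin.natAdd a i)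

namespace SubgraphGNN

/-- The feature dimensions of `separating`. -/
noncomputable def separatingDim (n m : ℕ) : ℕ → ℕ
  | 0 => m
  | l + 1 => separatingDim n m l + Fintype.card (RootedGraph.InvariantIndex n (separatingDim n m l))

/-- Each layer appends a complete set of invariants of the `k`-hop subgraph to the feature. -/
noncomputable def separating (n m L : ℕ) : SubgraphGNN m where
  L := L
  dim := separatingDim n m
  msgDim l := Fintype.card (RootedGraph.InvariantIndex n (separatingDim n m l))
  embed := id
  continuous_embed := continuous_id
  f _ := Euc.append
  continuous_f _ := Euc.continuous_append
  g _ := RootedGraph.invariant n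
  g_iso _ _ _ := RootedGraph.invariant_eq_of_iso n
  continuous_g _ := RootedGraph.continuous_invariant n

/-- Equal invariants give an isomorphism preserving features; by induction features determine
colors, so it also preserves colors. -/
theorem wlColor_eq_of_hidden_separating_eq {n m k L l : ℕ} {x y : GraphSpace n m} {i j : Fin n}
    (h : (separating n m L).hidden k x l i = (separating n m L).hidden k y l j) :
    wlColor k x l i = wlColor k y l j := by
  induction l generalizing i j with
  | zero => exact congrArg ULift.up h
  | succ l ih =>
    obtain ⟨h1, h2⟩ := Euc.append_inj h
    refine Prod.ext (ih h1) (Quotient.sound ?_)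
    have hcard : ∀ (z : GraphSpace n m) (a : Fin n),
        Nat.card (khopSubgraph k z.graph ((separating n m L).hidden k z l) a).V ≤ n := fun z a =>
      (Nat.card_le_card_of_injective (Subtype.val : {u : Fin n // u ∈
        {w : Fin n | z.graph.edist w a ≤ k}} → Fin n) Subtype.val_injective).trans
          (Nat.card_fin n).le
    obtain ⟨φ, hroot, hlab⟩ := RootedGraph.iso_of_invariant_eq (hcard x i) (hcard y j) h2
    exact ⟨φ, hroot, fun v => (ih (hlab v).symm).symm⟩

/-- Replace everything after layer `N.L` of `N` by a layer all of whose outputs are `ρ`. -/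
noncomputable def withReadout {m : ℕ} (N : SubgraphGNN m) (ρ : Euc (N.dim N.L) → ℝ)
    (hρ : Continuous ρ) : SubgraphGNN m where
  L := N.L + 1
  dim := N.dim
  msgDim := N.msgDim
  embed := N.embed
  continuous_embed := N.continuous_embed
  f l h w := if hl : l = N.L then WithLp.toLp 2 fun _ => ρ (hl ▸ h) else N.f l h w
  continuous_f l := by
    by_cases hl : l = N.L
    · subst hl
      simp only [dite_true]
      exact (PiLp.continuous_toLp 2 _).comp
        (continuous_pi fun _ => hρ.comp continuous_fst)
    · simp only [hl, dite_false]
      exact N.continuous_f l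
  g := N.g
  g_iso := N.g_iso
  continuous_g := N.continuous_g

/-- At graph level the readout acts only after aggregation, so `ρ` has to be evaluated inside a
layer. -/
theorem hidden_withReadout {n m k : ℕ} (N : SubgraphGNN m) (ρ : Euc (N.dim N.L) → ℝ)
    (hρ : Continuous ρ) (x : GraphSpace n m) (i : Fin n) :
    (N.withReadout ρ hρ).hidden k x (N.L + 1) i =
      WithLp.toLp 2 fun _ => ρ (N.hidden k x N.L i) := by
  have key : ∀ l ≤ N.L, (N.withReadout ρ hρ).hidden k x l = N.hidden k x l := by
    intro l
    induction l with
    | zero => exact fun _ => rfl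
    | succ l ih =>
      intro hl
      funext i
      simp only [hidden, ih (by omega)]
      exact dif_neg (by omega)
  simp only [hidden, key N.L le_rfl]
  exact dif_pos rfl

end SubgraphGNN

/-! ### Topology of the space of graphs -/

namespace GraphSpace

variable {n m : ℕ} {Z : Type*} [TopologicalSpace Z]

theorem continuous_iff {F : GraphSpace n m → Z} :
    Continuous F ↔ ∀ A : SimpleGraph (Fin n), Continuous fun H : Fin n → Euc m => F (A, H) := by
  let _ : TopologicalSpace (SimpleGraph (Fin n)) := ⊥
  have : DiscreteTopology (SimpleGraph (Fin n)) := ⟨rfl⟩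
  exact continuous_prod_of_discrete_left

theorem continuous_feature : Continuous (feature : GraphSpace n m → _) :=
  continuous_iff.2 fun _ => continuous_id

theorem continuous_hidden (N : SubgraphGNN m) (k l : ℕ) (i : Fin n) :
    Continuous fun x : GraphSpace n m => N.hidden k x l i := by
  refine continuous_iff.2 fun A => ?_
  induction l generalizing i with
  | zero => exact N.continuous_embed.comp (continuous_apply i)
  | succ l ih =>
    refine (N.continuous_f l).comp (Continuous.prodMk (ih i) ?_)
    exact (N.continuous_g l {u : Fin n // u ∈ {w : Fin n | A.edist w i ≤ k}}
      (A.induce {w : Fin n | A.edist w i ≤ k}) ⟨i, by simp⟩).comp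
        (continuous_pi (f := fun (H : Fin n → Euc m) (u : {u : Fin n // u ∈
          {w : Fin n | A.edist w i ≤ k}}) => N.hidden k ((A, H) : GraphSpace n m) l u.1)
          fun u => ih u.1)

/-- The connected graphs without cycles longer than `b` and with features bounded by `r`. -/
def good (n m b : ℕ) (r : ℝ) : Set (GraphSpace n m) :=
  {x | x.graph.Connected ∧ NoCycleLongerThan b x.graph ∧ ‖x.feature‖ ≤ r}

theorem isCompact_good (b : ℕ) (r : ℝ) : IsCompact (good n m b r) := by
  let _ : TopologicalSpace (SimpleGraph (Fin n)) := ⊥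
  have hs : good n m b r = {A : SimpleGraph (Fin n) | A.Connected ∧ NoCycleLongerThan b A} ×ˢ
      Metric.closedBall (0 : Fin n → Euc m) r := by
    refine Set.ext fun x => ?_
    have : x ∈ good n m b r ↔ (x.1.Connected ∧ NoCycleLongerThan b x.1) ∧
        x.2 ∈ Metric.closedBall (0 : Fin n → Euc m) r := by
      simp [good, graph, feature, and_assoc]
    exact this
  rw [hs]
  exact (Set.toFinite _).isCompact.prod (isCompact_closedBall _ _)

/-- The events that the features exceed `r` decrease to the empty set, so their measures tend to
zero. -/
theorem exists_measure_compl_good_lt (b : ℕ) (P : Measure (GraphSpace n m)) [IsFiniteMeasure P]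
    (hP : ∀ᵐ x ∂P, x.graph.Connected ∧ NoCycleLongerThan b x.graph) {ε : ENNReal} (hε : 0 < ε) :
    ∃ r, P (good n m b r)ᶜ < ε := by
  have hnorm : Continuous fun x : GraphSpace n m => ‖x.feature‖ := continuous_feature.norm
  have htend := tendsto_measure_iInter_atTop (μ := P)
    (s := fun r : ℕ => {x : GraphSpace n m | (r : ℝ) < ‖x.feature‖})
    (fun r => (isOpen_lt continuous_const hnorm).measurableSet.nullMeasurableSet)
    (fun a b hab x (hx : (b : ℝ) < _) => show (a : ℝ) < _ from (Nat.cast_le.2 hab).trans_lt hx) ⟨0, measure_ne_top _ _⟩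
  have hempty : ⋂ r : ℕ, {x : GraphSpace n m | (r : ℝ) < ‖x.feature‖} = ∅ := by
    refine Set.eq_empty_of_forall_notMem fun x hx => ?_
    obtain ⟨r, hr⟩ := exists_nat_ge ‖x.feature‖
    exact absurd (Set.mem_iInter.1 hx r) (not_lt.2 hr)
  rw [hempty, measure_empty] at htend
  obtain ⟨r, hr⟩ := (htend.eventually_lt_const hε).exists
  refine ⟨r, lt_of_le_of_lt ?_ hr⟩
  refine measure_mono_ae ?_
  filter_upwards [hP] with x hx hx'
  exact not_le.1 fun h => hx' ⟨hx.1, hx.2, h⟩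

end GraphSpace

/-! ### Universal approximation -/

/-- A continuous function on a compact space that is constant on the fibers of a continuous map
factors continuously through this map. -/
theorem exists_continuous_comp_eq {Y Z : Type*} [TopologicalSpace Y] [CompactSpace Y]
    [TopologicalSpace Z] [T2Space Z] [NormalSpace Z] {q : Y → Z} (hq : Continuous q) {ψ : Y → ℝ}
    (hψ : Continuous ψ) (h : ∀ a b, q a = q b → ψ a = ψ b) :
    ∃ ρ : Z → ℝ, Continuous ρ ∧ ∀ y, ρ (q y) = ψ y := by
  let q' : C(Y, Set.range q) := ⟨Set.rangeFactorization q, hq.subtype_mk _⟩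
  -- A continuous map from a compact to a Hausdorff space is closed, so `ψ` descends to the image.
  -- The image is closed, and Tietze's theorem extends the function to `Z`.
  have hquot : Topology.IsQuotientMap q' :=
    q'.continuous.isClosedMap.isQuotientMap q'.continuous Set.rangeFactorization_surjective
  have hfac : Function.FactorsThrough (⟨ψ, hψ⟩ : C(Y, ℝ)) q' := fun a b hab =>
    h a b (congrArg Subtype.val hab)
  let ρ₀ : C(Set.range q, ℝ) := hquot.lift ⟨ψ, hψ⟩ hfac
  obtain ⟨ρ, hρ⟩ := ρ₀.exists_restrict_eq (isCompact_range hq).isClosed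
  refine ⟨ρ, ρ.continuous, fun y => ?_⟩
  have h1 : ρ (q y) = ρ₀ (q' y) :=
    congrArg (fun g : C(Set.range q, ℝ) => g (q' y)) hρ
  rw [h1]
  exact congrArg (fun g : C(Y, ℝ) => g y) (hquot.lift_comp ⟨ψ, hψ⟩ hfac)

/-- Subgraph networks compute every continuous equivariant function exactly on bounded sets of
features. -/
theorem exists_subgraphGNN_eq {n m k : ℕ} (hk : 1 ≤ k) (r : ℝ) {Ψ : GraphSpace n m → Fin n → ℝ}
    (hΨ : ∀ i, Continuous fun x => Ψ x i) (hΨσ : ∀ σ x i, Ψ (x.relabel σ) (σ i) = Ψ x i) :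
    ∃ N : SubgraphGNN m, 0 < N.dim N.L ∧
      ∀ x ∈ GraphSpace.good n m (2 * k + 1) r, ∀ i j, N.hidden k x N.L i j = Ψ x i := by
  let N := SubgraphGNN.separating n m (n * n)
  let K := GraphSpace.good n m (2 * k + 1) r
  have : CompactSpace K := isCompact_iff_compactSpace.1 (GraphSpace.isCompact_good _ _)
  -- Pairing graphs with vertices yields one readout for all vertices. Equal features force a
  -- relabelling taking `i` to `j`, under which equivariance gives equal values.
  obtain ⟨ρ, hρ, hρΨ⟩ := exists_continuous_comp_eq (Y := K × Fin n)
    (q := fun p => N.hidden k p.1.1 N.L p.2) (ψ := fun p => Ψ p.1.1 p.2)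
    (continuous_prod_of_discrete_right.2 fun i =>
      (GraphSpace.continuous_hidden N k N.L i).comp continuous_subtype_val)
    (continuous_prod_of_discrete_right.2 fun i => (hΨ i).comp continuous_subtype_val) (by
      rintro ⟨⟨x, hx⟩, i⟩ ⟨⟨y, hy⟩, j⟩ h
      obtain ⟨σ, rfl, rfl⟩ := exists_relabel_of_wlColor_eq hk hx.1 hx.2.1 hy.2.1
        (SubgraphGNN.wlColor_eq_of_hidden_separating_eq h)
      exact (hΨσ σ x i).symm)
  refine ⟨N.withReadout ρ hρ, ?_, fun x hx i j => ?_⟩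
  · change 0 < SubgraphGNN.separatingDim n m (n * n + 1)
    exact Nat.add_pos_right _ Fintype.card_pos
  · have := N.hidden_withReadout (k := k) ρ hρ x i
    exact (congrArg (fun w : Euc _ => w j) this).trans (hρΨ (⟨x, hx⟩, i))

/-- Aggregating copies of the same number determines this number. -/
theorem Aggregation.exists_readout (a : Aggregation) (n : ℕ) [NeZero n] {d : ℕ} (j : Fin d) :
    ∃ r : Euc d → ℝ, Continuous r ∧ ∀ (h : Fin n → Euc d) (t : ℝ), (∀ i, h i j = t) →
      r (a.aggr (Finset.univ.val.map h)) = t := by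
  have hn : (n : ℝ) ≠ 0 := Nat.cast_ne_zero.2 (NeZero.ne n)
  have hsum : ∀ (h : Fin n → Euc d) (t : ℝ), (∀ i, h i j = t) →
      (Finset.univ.val.map h).sum j = n * t := by
    intro h t ht
    change (∑ i, h i) j = n * t
    simp [ht]
  cases a with
  | sum =>
    refine ⟨fun y => (n : ℝ)⁻¹ * y j, by fun_prop, fun h t ht => ?_⟩
    simp only [Aggregation.aggr, hsum h t ht]
    field_simp
  | mean =>
    refine ⟨fun y => y j, by fun_prop, fun h t ht => ?_⟩
    simp only [Aggregation.aggr, PiLp.smul_apply, hsum h t ht]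
    simp [hn]
  | max =>
    refine ⟨fun y => y j, by fun_prop, fun h t ht => ?_⟩
    have : {s : ℝ | ∃ y ∈ Finset.univ.val.map h, s = y j} = {t} := by
      ext s
      simp [ht]
    simp only [Aggregation.aggr, this, csSup_singleton]

/-- On connected graphs without cycles longer than `2k+1`, the Weisfeiler-Lehman colors already
determine the graph, so that `k`-separability is not used. -/
theorem mainTheorem1 (n m k : ℕ) (hk : 2 ≤ k)
    (P : Measure (GraphSpace n m)) [IsProbabilityMeasure P]
    (hP : ∀ᵐ x ∂P, KSeparable k x ∧ x.graph.Connected ∧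
      NoCycleLongerThan (2 * k + 1) x.graph) :
    (∀ (a : Aggregation) (ε δ : ℝ), 0 < ε → 0 < δ →
      ∀ Φ : GraphSpace n m → ℝ, Continuous Φ → PermInvariant Φ →
        ∃ F ∈ graphLevelGNN n m k a, P {x | δ < |F x - Φ x|} < ENNReal.ofReal ε) ∧
    (∀ ε δ : ℝ, 0 < ε → 0 < δ →
      ∀ Φ : GraphSpace n m → Euc n, Continuous Φ → PermEquivariant Φ →
        ∃ F ∈ vertexLevelGNN n m k, P {x | δ < ‖F x - Φ x‖} < ENNReal.ofReal ε) := by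
  have hk1 : 1 ≤ k := by omega
  have hgood : ∀ ε : ℝ, 0 < ε → ∃ r, P (GraphSpace.good n m (2 * k + 1) r)ᶜ < ENNReal.ofReal ε :=
    fun ε hε => GraphSpace.exists_measure_compl_good_lt _ P (hP.mono fun _ h => h.2)
      (ENNReal.ofReal_pos.2 hε)
  obtain ⟨x₀, -, hx₀, -⟩ := hP.exists
  -- A connected graph has a vertex; undoing the aggregation needs at least one summand.
  have : NeZero n := ⟨fun h => (Fin.cast h hx₀.nonempty.some).elim0⟩
  constructor
  · intro a ε δ hε hδ Φ hΦ hΦσ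
    obtain ⟨R, hR⟩ := hgood ε hε
    -- An invariant function is treated as an equivariant one with equal entries, so all vertices
    -- carry the same number into the aggregation.
    obtain ⟨N, hN, hNΦ⟩ := exists_subgraphGNN_eq hk1 R (Ψ := fun x _ => Φ x) (fun _ => hΦ)
      (fun σ x _ => hΦσ σ x)
    obtain ⟨r, hr, hrt⟩ := a.exists_readout n (⟨0, hN⟩ : Fin (N.dim N.L))
    refine ⟨_, ⟨N, r, hr, fun x => rfl⟩, (measure_mono ?_).trans_lt hR⟩
    intro x hx hxR
    have hx' : δ < |r (a.aggr (Finset.univ.val.map (N.hidden k x N.L))) - Φ x| := hx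
    rw [hrt _ (Φ x) fun i => hNΦ x hxR i _, sub_self, abs_zero] at hx'
    exact hδ.not_gt hx'
  · intro ε δ hε hδ Φ hΦ hΦσ
    obtain ⟨R, hR⟩ := hgood ε hε
    obtain ⟨N, hN, hNΦ⟩ := exists_subgraphGNN_eq hk1 R (Ψ := fun x i => Φ x i)
      (fun i => by fun_prop) (fun σ x i => by rw [hΦσ σ x]; simp)
    refine ⟨_, ⟨N, fun y => y ⟨0, hN⟩, by fun_prop, fun x => rfl⟩,
      (measure_mono ?_).trans_lt hR⟩
    intro x hx hxR
    have hx' : δ < ‖WithLp.toLp 2 (fun i => N.hidden k x N.L i ⟨0, hN⟩) - Φ x‖ := hx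
    have heq : WithLp.toLp 2 (fun i => N.hidden k x N.L i ⟨0, hN⟩) = Φ x := by
      ext i
      exact hNΦ x hxR i _
    rw [heq, sub_self, norm_zero] at hx'
    exact hδ.not_gt hx'
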